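/- All vector spaces are over $\mathbb{C}$. Let $(V,Y,\mathbf 1,\omega)$ be a vertex operator algebra, $Y(a,z)=\sum_{n\in\mathbb Z}a_nz^{-n-1}$, $L(n)=\omega_{n+1}$; thus $V=\bigoplus_{n\in\mathbb Z}V_n$ with $V_n=\{a\in V: L(0)a=na\}$ finite-dimensional and $V_n=0$ for all sufficiently small $n$. A weak $V$-module is a vector space $M$ with a linear map $a\mapsto Y_M(a,z)=\sum_{n\in\mathbb Z}a_nz^{-n-1}$, $a_n\in\operatorname{End}M$, such that $a_nw=0$ for $n\gg0$ (for all $a\in V$, $w\in M$), $Y_M(\mathbf 1,z)=\mathrm{id}_M$, and the Jacobi identity holds. A (weak) submodule is a subspace stable under all $a_n$. A $V$-module is a weak $V$-module $M$ with $M=\bigoplus_{\lambda\in\mathbb C}M_\lambda$, $M_\lambda=\{w\in M: L(0)w=\lambda w\}$, such that every $M_\lambda$ is finite-dimensional and, for each fixed $\lambda$, $M_{\lambda+n}=0$ for all sufficiently small integers $n$. It is simple if it is nonzero and $0$ and $M$ are its only submodules, and completely reducible if it is a direct sum of simple $V$-modules. An admissible $V$-module is a weak $V$-module $M$ with a grading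 $M=\bigoplus_{n\in\mathbb Z_{\ge0}}M(n)$ such that $a_mM(n)\subseteq M(n+k-m-1)$ for all $a\in V_k$, $k,m\in\mathbb Z$ (with $M(j)=0$ for $j<0$). It is simple if it is nonzero and $0$ and $M$ are its only graded submodules. $V$ is rational if every admissible $V$-module is a direct sum of simple admissible (graded) submodules. $V$ is holomorphic if $V$ is, up to isomorphism, the only simple $V$-module. Proposition. Suppose that $V$ is a holomorphic vertex operator algebra, and that $V$ contains a vertex operator subalgebra $U$ (a subspace containing $\mathbf 1$ and $\omega$ and closed under all products $a_nb$) with the same Virasoro element $\omega$ which, as a vertex operator algebra, is rational. Then every $V$-module is completely reducible. -/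

import Mathlib

universe u v

/-- The coefficients of the Jacobi identity
`z₀⁻¹ δ((z₁ - z₂)/z₀) Y_M(a, z₁) Y_M(b, z₂) - z₀⁻¹ δ((z₂ - z₁)/(-z₀)) Y_M(b, z₂) Y_M(a, z₁)
  = z₂⁻¹ δ((z₁ - z₀)/z₂) Y_M(Y(a, z₀) b, z₂)`
at `z₀ ^ (-l-1) z₁ ^ (-m-1) z₂ ^ (-n-1)`, where `Y(a, z) = ∑ a_n z ^ (-n-1)`, `a_n = y n a`, and
`Y_M(a, z) = ∑ a_n z ^ (-n-1)`, `a_n = yM n a`. Under the truncation axioms (assumed wherever this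
is used) each of the three sums over `i` has finite support. -/
def JacobiIdentity {V : Type u} [AddCommGroup V] [Module ℂ V] {M : Type v} [AddCommGroup M]
    [Module ℂ M] (y : ℤ → V →ₗ[ℂ] Module.End ℂ V) (yM : ℤ → V →ₗ[ℂ] Module.End ℂ M) : Prop :=
  ∀ (a b : V) (w : M) (l m n : ℤ),
    (∑ᶠ i : ℕ, ((-1 : ℂ) ^ i * (Ring.choose l i : ℂ)) • yM (m + l - i) a (yM (n + i) b w))
      - (∑ᶠ i : ℕ, ((-1 : ℂ) ^ l * (-1 : ℂ) ^ i * (Ring.choose l i : ℂ)) •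
          yM (n + l - i) b (yM (m + i) a w))
      = ∑ᶠ i : ℕ, (Ring.choose m i : ℂ) • yM (m + n - i) (y (l + i) a b) w

/-- A vertex operator algebra structure `(V, Y, 𝟏, ω)` on a complex vector space `V`. The vertex
operators are `Y(a, z) = ∑ a_n z ^ (-n-1)` with `a_n = mode n a`, and `L(n) = ω_{n+1}`.
The ℤ-grading of `V` is the decomposition into the eigenspaces `V_n` of `L(0)`; eigenspaces are
automatically independent, so that `V = ⨁ V_n` says that they span. -/
structure VertexOperatorAlgebra (V : Type u) [AddCommGroup V] [Module ℂ V] where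
  /-- `mode n a` is the endomorphism `a_n`. -/
  mode : ℤ → V →ₗ[ℂ] Module.End ℂ V
  /-- The vacuum vector `𝟏`. -/
  vac : V
  /-- The Virasoro element `ω`. -/
  omega : V
  /-- The rank (central charge). -/
  rank : ℂ
  truncation : ∀ a b : V, ∃ N : ℤ, ∀ n : ℤ, N ≤ n → mode n a b = 0
  vacuum : ∀ (n : ℤ) (b : V), mode n vac b = if n = -1 then b else 0
  creation : ∀ a : V, mode (-1) a vac = a
  creation_nonneg : ∀ (a : V) (n : ℤ), 0 ≤ n → mode n a vac = 0
  jacobi : JacobiIdentity mode mode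
  virasoro : ∀ (m n : ℤ) (b : V),
    mode (m + 1) omega (mode (n + 1) omega b) - mode (n + 1) omega (mode (m + 1) omega b)
      = ((m : ℂ) - n) • mode (m + n + 1) omega b
        + (if m + n = 0 then ((m : ℂ) ^ 3 - m) / 12 * rank else 0) • b
  derivative : ∀ (a b : V) (n : ℤ),
    mode n (mode 0 omega a) b = (-(n : ℂ)) • mode (n - 1) a b
  grading : ⨆ n : ℤ, Module.End.eigenspace (mode 1 omega) (n : ℂ) = ⊤
  finite_weight : ∀ n : ℤ,
    FiniteDimensional ℂ (Module.End.eigenspace (mode 1 omega) (n : ℂ))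
  lower_bound : ∃ N : ℤ, ∀ n : ℤ, n < N →
    Module.End.eigenspace (mode 1 omega) (n : ℂ) = ⊥

namespace VertexOperatorAlgebra

section

variable {V : Type u} [AddCommGroup V] [Module ℂ V]

/-- The weight space `V_n = {a | L(0) a = n a}`. -/
def weightSpace (A : VertexOperatorAlgebra V) (n : ℤ) : Submodule ℂ V :=
  Module.End.eigenspace (A.mode 1 A.omega) (n : ℂ)

/-- A weak module structure on `M` over the vertex operator algebra `A`, with
`Y_M(a, z) = ∑ a_n z ^ (-n-1)`, `a_n = mode n a`. -/
structure WeakModule (A : VertexOperatorAlgebra V) (M : Type v) [AddCommGroup M]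
    [Module ℂ M] where
  /-- `mode n a` is the endomorphism `a_n` of `M`. -/
  mode : ℤ → V →ₗ[ℂ] Module.End ℂ M
  truncation : ∀ (a : V) (w : M), ∃ N : ℤ, ∀ n : ℤ, N ≤ n → mode n a w = 0
  vacuum : ∀ (n : ℤ) (w : M), mode n A.vac w = if n = -1 then w else 0
  jacobi : JacobiIdentity A.mode mode

namespace WeakModule

variable {A : VertexOperatorAlgebra V} {M : Type v} [AddCommGroup M] [Module ℂ M]

/-- The eigenspace `M_z = {w | L(0) w = z w}`. -/
def weightSpace (W : A.WeakModule M) (z : ℂ) : Submodule ℂ M :=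
  Module.End.eigenspace (W.mode 1 A.omega) z

/-- `W` is an (ordinary) `V`-module: `M` is the direct sum of the eigenspaces `M_z` of `L(0)`
(eigenspaces are automatically independent), every `M_z` is finite-dimensional, and for fixed `z`,
`M_{z+n} = 0` for all small enough integers `n`. -/
structure IsOrdinary (W : A.WeakModule M) : Prop where
  grading : ⨆ z : ℂ, W.weightSpace z = ⊤
  finite_weight : ∀ z : ℂ, FiniteDimensional ℂ (W.weightSpace z)
  lower_bound : ∀ z : ℂ, ∃ N : ℤ, ∀ n : ℤ, n < N → W.weightSpace (z + n) = ⊥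

/-- The subspace `K` is a submodule: it is stable under all `a_n`. -/
def IsSubmodule (W : A.WeakModule M) (K : Submodule ℂ M) : Prop :=
  ∀ (a : V) (n : ℤ), ∀ w ∈ K, W.mode n a w ∈ K

/-- The subspace `K` is a simple submodule. -/
def IsSimpleSubmodule (W : A.WeakModule M) (K : Submodule ℂ M) : Prop :=
  W.IsSubmodule K ∧ K ≠ ⊥ ∧ ∀ K' ≤ K, W.IsSubmodule K' → K' = ⊥ ∨ K' = K

/-- `W` is simple: it is nonzero, and `0` and `M` are its only submodules. -/
def IsSimple (W : A.WeakModule M) : Prop := W.IsSimpleSubmodule ⊤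

/-- `W` is completely reducible: it is the (internal) direct sum of a set of simple
submodules. -/
def IsCompletelyReducible (W : A.WeakModule M) : Prop :=
  ∃ S : Set (Submodule ℂ M), (∀ K ∈ S, W.IsSimpleSubmodule K) ∧ sSupIndep S ∧ sSup S = ⊤

/-- Equivalence of modules: a linear isomorphism commuting with the vertex operators. -/
def Equivalent {M' : Type*} [AddCommGroup M'] [Module ℂ M'] (W : A.WeakModule M)
    (W' : A.WeakModule M') : Prop :=
  ∃ f : M ≃ₗ[ℂ] M', ∀ (a : V) (n : ℤ) (w : M), f (W.mode n a w) = W'.mode n a (f w)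

/-- The family `G` makes `W` an admissible module: `M = ⨁_{n ≥ 0} G n`, and
`a_m G(n) ⊆ G(n + wt a - m - 1)` for homogeneous `a`. The index runs through `ℤ`, with
`G n = 0` for `n < 0`. -/
structure IsAdmissible (W : A.WeakModule M) (G : ℤ → Submodule ℂ M) : Prop where
  internal : DirectSum.IsInternal G
  nonneg : ∀ n : ℤ, n < 0 → G n = ⊥
  mode_mem : ∀ (k : ℤ), ∀ a ∈ A.weightSpace k, ∀ (m n : ℤ), ∀ w ∈ G n,
    W.mode m a w ∈ G (n + k - m - 1)

/-- `K` is a graded submodule: a submodule with `K = ⨁ (K ∩ G n)`. -/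
def IsGradedSubmodule (W : A.WeakModule M) (G : ℤ → Submodule ℂ M) (K : Submodule ℂ M) : Prop :=
  W.IsSubmodule K ∧ ⨆ n : ℤ, K ⊓ G n = K

/-- `K` is simple as an admissible module, that is, with respect to graded submodules. -/
def IsSimpleGradedSubmodule (W : A.WeakModule M) (G : ℤ → Submodule ℂ M)
    (K : Submodule ℂ M) : Prop :=
  W.IsGradedSubmodule G K ∧ K ≠ ⊥ ∧ ∀ K' ≤ K, W.IsGradedSubmodule G K' → K' = ⊥ ∨ K' = K

/-- The admissible module `(W, G)` is completely reducible: it is the (internal) direct sum of a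
set of graded submodules that are simple admissible modules. -/
def IsCompletelyReducibleGraded (W : A.WeakModule M) (G : ℤ → Submodule ℂ M) : Prop :=
  ∃ S : Set (Submodule ℂ M),
    (∀ K ∈ S, W.IsSimpleGradedSubmodule G K) ∧ sSupIndep S ∧ sSup S = ⊤

end WeakModule

/-- `V` as a module over itself. -/
def regular (A : VertexOperatorAlgebra V) : A.WeakModule V where
  mode := A.mode
  truncation := A.truncation
  vacuum := A.vacuum
  jacobi := A.jacobi

/-- `V` is rational: every admissible `V`-module is completely reducible. -/
def IsRational (A : VertexOperatorAlgebra V) : Prop :=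
  ∀ (M : Type u) [AddCommGroup M] [Module ℂ M] (W : A.WeakModule M) (G : ℤ → Submodule ℂ M),
    W.IsAdmissible G → W.IsCompletelyReducibleGraded G

/-- `V` is holomorphic: `V` is the only simple (ordinary) `V`-module up to equivalence. -/
def IsHolomorphic (A : VertexOperatorAlgebra V) : Prop :=
  (A.regular.IsOrdinary ∧ A.regular.IsSimple) ∧
    ∀ (M : Type u) [AddCommGroup M] [Module ℂ M] (W : A.WeakModule M),
      W.IsOrdinary → W.IsSimple → W.Equivalent A.regular

/-- The subspace `U` is a vertex operator subalgebra of `V` with the same Virasoro element. -/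
structure IsSubalgebra (A : VertexOperatorAlgebra V) (U : Submodule ℂ V) : Prop where
  vac_mem : A.vac ∈ U
  omega_mem : A.omega ∈ U
  mode_mem : ∀ (n : ℤ), ∀ a ∈ U, ∀ b ∈ U, A.mode n a b ∈ U

/-- The restriction of the vertex operators to a subalgebra. -/
def subMode (A : VertexOperatorAlgebra V) (U : Submodule ℂ V) (hU : A.IsSubalgebra U) (n : ℤ) :
    U →ₗ[ℂ] Module.End ℂ U where
  toFun a := (A.mode n (a : V)).restrict (hU.mode_mem n a a.2)
  map_add' a b := by ext c; simp [LinearMap.restrict_apply]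
  map_smul' r a := by ext c; simp [LinearMap.restrict_apply]

theorem coe_subMode (A : VertexOperatorAlgebra V) (U : Submodule ℂ V) (hU : A.IsSubalgebra U)
    (n : ℤ) (a b : U) : (A.subMode U hU n a b : V) = A.mode n (a : V) (b : V) := rfl

theorem eigenspace_subMode (A : VertexOperatorAlgebra V) (U : Submodule ℂ V)
    (hU : A.IsSubalgebra U) (z : ℂ) :
    Module.End.eigenspace (A.subMode U hU 1 ⟨A.omega, hU.omega_mem⟩) z
      = (Module.End.eigenspace (A.mode 1 A.omega) z).comap U.subtype := by
  ext x
  simp only [Module.End.mem_eigenspace_iff, Submodule.mem_comap, Submodule.subtype_apply]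
  rw [Subtype.ext_iff, coe_subMode]
  simp

/-- If a sum of eigenvectors for distinct eigenvalues lies in a stable subspace, so do its terms. -/
theorem mem_of_sum_mem (f : Module.End ℂ V) (U : Submodule ℂ V) (hU : ∀ x ∈ U, f x ∈ U)
    (s : Finset ℤ) : ∀ x : ℤ → V, (∀ n ∈ s, x n ∈ f.eigenspace (n : ℂ)) →
      ∑ n ∈ s, x n ∈ U → ∀ n ∈ s, x n ∈ U := by
  induction s using Finset.induction_on with
  | empty => simp
  | insert k s hk ih =>
    intro x hx hsum
    have h1 : ∑ n ∈ s, ((n : ℂ) - k) • x n ∈ U := by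
      have h2 := U.sub_mem (hU _ hsum) (U.smul_mem (k : ℂ) hsum)
      convert h2 using 1
      rw [map_sum, Finset.smul_sum, ← Finset.sum_sub_distrib, Finset.sum_insert hk,
        Module.End.mem_eigenspace_iff.mp (hx k (Finset.mem_insert_self k s)), sub_self, zero_add]
      refine Finset.sum_congr rfl fun n hn => ?_
      rw [Module.End.mem_eigenspace_iff.mp (hx n (Finset.mem_insert_of_mem hn)), sub_smul]
    have h3 : ∀ n ∈ s, x n ∈ U := by
      intro n hn
      have h4 := ih (fun n => ((n : ℂ) - k) • x n)
        (fun n hn => Submodule.smul_mem _ _ (hx n (Finset.mem_insert_of_mem hn))) h1 n hn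
      have hne : (n : ℂ) - k ≠ 0 := by
        rw [sub_ne_zero, Int.cast_injective.ne_iff]
        rintro rfl
        exact hk hn
      exact (Submodule.smul_mem_iff U hne).mp h4
    intro n hn
    rcases Finset.mem_insert.mp hn with rfl | hn
    · rw [Finset.sum_insert hk] at hsum
      exact (Submodule.add_mem_iff_left U (U.sum_mem h3)).mp hsum
    · exact h3 n hn

theorem iSup_eigenspace_subMode (A : VertexOperatorAlgebra V) (U : Submodule ℂ V)
    (hU : A.IsSubalgebra U) :
    ⨆ n : ℤ, Module.End.eigenspace (A.subMode U hU 1 ⟨A.omega, hU.omega_mem⟩) (n : ℂ) = ⊤ := by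
  rw [eq_top_iff]
  rintro ⟨x, hxU⟩ -
  have hx : x ∈ ⨆ n : ℤ, Module.End.eigenspace (A.mode 1 A.omega) (n : ℂ) := by
    rw [A.grading]; trivial
  obtain ⟨g, hg, rfl⟩ := (Submodule.mem_iSup_iff_exists_finsupp _ _).mp hx
  have hmem : ∀ n ∈ g.support, g n ∈ U :=
    mem_of_sum_mem (A.mode 1 A.omega) U (fun y hy => hU.mode_mem 1 _ hU.omega_mem y hy)
      g.support g (fun n _ => hg n) hxU
  have hsum : (⟨g.sum fun _ y => y, hxU⟩ : U)
      = ∑ n ∈ g.support.attach, ⟨g n, hmem n n.2⟩ := by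
    apply Subtype.ext
    rw [Submodule.coe_sum]
    exact (Finset.sum_attach g.support g).symm
  rw [hsum]
  refine Submodule.sum_mem _ fun n _ => ?_
  refine Submodule.mem_iSup_of_mem (n : ℤ) ?_
  rw [eigenspace_subMode]
  exact hg n

/-- A vertex operator subalgebra, as a vertex operator algebra in its own right, with the same
vacuum and the same Virasoro element. -/
def subalgebra (A : VertexOperatorAlgebra V) (U : Submodule ℂ V) (hU : A.IsSubalgebra U) :
    VertexOperatorAlgebra U where
  mode := A.subMode U hU
  vac := ⟨A.vac, hU.vac_mem⟩
  omega := ⟨A.omega, hU.omega_mem⟩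
  rank := A.rank
  truncation a b := by
    obtain ⟨N, hN⟩ := A.truncation a b
    exact ⟨N, fun n hn => Subtype.ext (hN n hn)⟩
  vacuum n b := by
    apply Subtype.ext
    rw [coe_subMode, A.vacuum]
    split_ifs <;> rfl
  creation a := Subtype.ext (A.creation a)
  creation_nonneg a n hn := Subtype.ext (A.creation_nonneg a n hn)
  jacobi a b w l m n := by
    have key : ∀ f : ℕ → U, ((∑ᶠ i, f i : U) : V) = ∑ᶠ i, (f i : V) := fun f =>
      U.subtype.toAddMonoidHom.map_finsum_of_injective Subtype.val_injective f
    apply Subtype.ext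
    rw [Submodule.coe_sub, key, key, key]
    exact A.jacobi a b w l m n
  virasoro m n b :=
     Subtype.ext (A.virasoro m n b)
  derivative a b n := Subtype.ext (A.derivative a b n)
  grading := A.iSup_eigenspace_subMode U hU
  finite_weight n := by
    rw [eigenspace_subMode]
    have := A.finite_weight n
    exact FiniteDimensional.of_injective
      (U.subtype.restrict (p := (Module.End.eigenspace (A.mode 1 A.omega) (n : ℂ)).comap U.subtype)
        (q := Module.End.eigenspace (A.mode 1 A.omega) (n : ℂ)) (fun _ hx => hx))
      (fun x y h => by
        have h' := Subtype.ext_iff.mp h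
        exact Subtype.ext (Subtype.ext h'))
  lower_bound := by
    obtain ⟨N, hN⟩ := A.lower_bound
    refine ⟨N, fun n hn => ?_⟩
    rw [eigenspace_subMode, hN n hn]
    simp

end

end VertexOperatorAlgebra

/-! Let `S` be the sum of all simple submodules of `M`. If `x ∉ S`, the submodule `P` generated by
`x` has a maximal submodule `C` containing `P ∩ S`. The quotient `P / C` is a simple ordinary
module, hence isomorphic to `V` because `V` is holomorphic. A simple submodule of `P` not contained
in `C` then contradicts `P ∩ S ≤ C`.

Such a submodule comes from lifting the vacuum along `g : P → V` (`exists_vacuumLike_lift`). The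
part of `P` of integral weights is an admissible `U`-module, so rationality of `U` gives a
`U`-stable complement of the kernel of `g` in it. Let `c` in the complement lift `𝟏`. Since `ω ∈ U`,
the vector `L(-1) c` stays in the complement; since `L(-1) 𝟏 = 0`, it also lies in the kernel. Hence
`L(-1) c = 0`.

By the Jacobi identity such a vector behaves like a vacuum: `a_n c = 0` for `n ≥ 0`, and `a ↦ a_{-1}
c` is a `V`-homomorphism `V → P` (`mode_neg_one_mode`). Its image is simple because `V` is, and
contains `c ∉ C`. -/

/-! ### Semisimple operators -/

namespace Module.End

variable {E F : Type*} [AddCommGroup E] [Module ℂ E] [AddCommGroup F] [Module ℂ F]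

/-- A surjection that intertwines `f` with `f'` maps eigenspaces of a diagonalizable `f` onto
eigenspaces of `f'`. -/
theorem map_eigenspace_of_surjective {f : Module.End ℂ E} {f' : Module.End ℂ F} (g : E →ₗ[ℂ] F)
    (hg : Function.Surjective g) (hc : ∀ x, g (f x) = f' (g x))
    (hf : ⨆ z, f.eigenspace z = ⊤) (z : ℂ) :
    (f.eigenspace z).map g = f'.eigenspace z := by
  have hle : ∀ z, (f.eigenspace z).map g ≤ f'.eigenspace z := by
    rintro z _ ⟨x, hx, rfl⟩
    rw [mem_eigenspace_iff, ← hc, mem_eigenspace_iff.mp hx, map_smul]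
  refine le_antisymm (hle z) ?_
  have htop : ⨆ z, (f.eigenspace z).map g = ⊤ := by
    rw [← Submodule.map_iSup, hf, Submodule.map_top, LinearMap.range_eq_top.mpr hg]
  have hsplit : (f.eigenspace z).map g ⊔ ⨆ (j) (_ : j ≠ z), (f.eigenspace j).map g = ⊤ := by
    rw [eq_top_iff, ← htop]
    refine iSup_le fun j => ?_
    by_cases hj : j = z
    · exact hj ▸ le_sup_left
    · exact le_sup_of_le_right (le_iSup₂_of_le j hj le_rfl)
  have hdisj := f'.eigenspaces_iSupIndep z
  intro y hy
  obtain ⟨a, ha, b, hb, rfl⟩ := Submodule.mem_sup.mp (hsplit ▸ Submodule.mem_top (x := y))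
  have hb' : b ∈ ⨆ (j) (_ : j ≠ z), f'.eigenspace j :=
    iSup₂_mono (fun j _ => hle j) hb
  -- The difference `b = (a + b) - a` is in the `z`-eigenspace as well as in the sum of the others,
  -- so independence kills it.
  have hb0 : b = 0 := Submodule.disjoint_def.mp hdisj b
    ((Submodule.add_mem_iff_right _ (hle z ha)).mp hy) hb'
  simpa [hb0] using ha

/-- A stable subspace of a diagonalizable operator is the sum of its eigenspaces. -/
theorem iSup_inf_eigenspace {ι : Type*} {e : ι → ℂ} (he : Function.Injective e)
    {f : Module.End ℂ E} (hf : ⨆ i, f.eigenspace (e i) = ⊤)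
    (K : Submodule ℂ E) (hK : ∀ x ∈ K, f x ∈ K) : ⨆ i, K ⊓ f.eigenspace (e i) = K := by
  refine le_antisymm (iSup_le fun i => inf_le_left) fun x hx => ?_
  classical
  obtain ⟨c, hc, rfl⟩ := (Submodule.mem_iSup_iff_exists_finsupp _ _).mp
    (hf ▸ Submodule.mem_top (x := x))
  -- Modulo `K` the components become eigenvectors for distinct eigenvalues with sum zero, so each
  -- component lies in `K`.
  let f' : Module.End ℂ (E ⧸ K) := K.mapQ K f hK
  have hmem : ∀ i, K.mkQ (c i) ∈ f'.eigenspace (e i) := fun i => by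
    rw [mem_eigenspace_iff]
    change K.mkQ (f (c i)) = _
    rw [mem_eigenspace_iff.mp (hc i), map_smul]
  have hsum : ∑ i ∈ c.support, K.mkQ (c i) = 0 := by
    rw [← map_sum]
    exact (Submodule.Quotient.mk_eq_zero K).mpr hx
  refine Submodule.sum_mem _ fun i hi => Submodule.mem_iSup_of_mem i ⟨?_, hc i⟩
  have := (iSupIndep_iff_finsetSum_eq_zero_imp_eq_zero _).mp (f'.eigenspaces_iSupIndep.comp he)
    c.support (fun i => K.mkQ (c i)) (fun i _ => hmem i) hsum i hi
  exact (Submodule.Quotient.mk_eq_zero K).mp this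

theorem map_subtype_eigenspace_restrict (f : Module.End ℂ E)
    (K : Submodule ℂ E) (hK : ∀ x ∈ K, f x ∈ K) (z : ℂ) :
    (eigenspace (f.restrict hK) z).map K.subtype = K ⊓ f.eigenspace z := by
  ext x
  constructor
  · rintro ⟨y, hy, rfl⟩
    exact ⟨y.2, mem_eigenspace_iff.mpr (congrArg K.subtype (mem_eigenspace_iff.mp hy))⟩
  · rintro ⟨h, hx⟩
    exact ⟨⟨x, h⟩, mem_eigenspace_iff.mpr (Subtype.ext (mem_eigenspace_iff.mp hx)), rfl⟩

theorem iSup_eigenspace_restrict {ι : Type*} {e : ι → ℂ} {f : Module.End ℂ E}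
    (K : Submodule ℂ E) (hK : ∀ x ∈ K, f x ∈ K) (h : ⨆ i, K ⊓ f.eigenspace (e i) = K) :
    ⨆ i, eigenspace (f.restrict hK) (e i) = ⊤ := by
  apply Submodule.map_injective_of_injective K.injective_subtype
  simp_rw [Submodule.map_iSup, map_subtype_eigenspace_restrict, h, Submodule.map_top,
    Submodule.range_subtype]

end Module.End

namespace VertexOperatorAlgebra

/-! ### Consequences of the Jacobi identity -/

/-- Needed for the iterate formula at `l = -2`, since `L(-1) a = a_{-2} 𝟏`. -/
theorem choose_neg_two (i : ℕ) : Ring.choose (-2 : ℂ) i = (-1) ^ i * (i + 1) := by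
  rw [Ring.choose_neg, show (2 : ℂ) + i - 1 = ((i + 1 : ℕ) : ℂ) by push_cast; ring,
    Ring.choose_natCast, Nat.choose_succ_self_right, Int.negOnePow_def, Units.smul_def]
  simp [mul_add]

theorem choose_zero_of_ne {i : ℕ} (hi : i ≠ 0) : Ring.choose (0 : ℂ) i = 0 :=
  Ring.choose_zero_pos ℂ (Nat.pos_of_ne_zero hi)

theorem choose_one (i : ℕ) : Ring.choose (1 : ℂ) i = Nat.choose 1 i := by
  simpa using Ring.choose_natCast (R := ℂ) 1 i

namespace WeakModule

variable {V : Type u} [AddCommGroup V] [Module ℂ V] {A : VertexOperatorAlgebra V}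
  {M : Type v} [AddCommGroup M] [Module ℂ M]

/-- The iterate formula. -/
theorem mode_mode (W : A.WeakModule M) (a b : V) (w : M) (l n : ℤ) :
    W.mode n (A.mode l a b) w =
      (∑ᶠ i : ℕ, ((-1 : ℂ) ^ i * (Ring.choose l i : ℂ)) • W.mode (l - i) a (W.mode (n + i) b w))
      - (∑ᶠ i : ℕ, ((-1 : ℂ) ^ l * (-1 : ℂ) ^ i * (Ring.choose l i : ℂ)) •
          W.mode (n + l - i) b (W.mode i a w)) := by
  -- At `m = 0` the right-hand side collapses to its term `i = 0`.
  have h := W.jacobi a b w l 0 n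
  rw [finsum_eq_single (fun i : ℕ => Ring.choose ((0 : ℤ) : ℂ) i • _) 0
    (fun i hi => by rw [Int.cast_zero, choose_zero_of_ne hi]; simp)] at h
  simpa using h.symm

/-- The commutator formula. -/
theorem commutator (W : A.WeakModule M) (a b : V) (w : M) (m n : ℤ) :
    W.mode m a (W.mode n b w) - W.mode n b (W.mode m a w) =
      ∑ᶠ i : ℕ, (Ring.choose m i : ℂ) • W.mode (m + n - i) (A.mode i a b) w := by
  -- At `l = 0` both sums on the left collapse to `i = 0`.
  have h := W.jacobi a b w 0 m n
  rw [finsum_eq_single (fun i : ℕ => ((-1 : ℂ) ^ i * Ring.choose ((0 : ℤ) : ℂ) i) • _) 0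
    (fun i hi => by rw [Int.cast_zero, choose_zero_of_ne hi]; simp),
    finsum_eq_single (fun i : ℕ => ((-1 : ℂ) ^ (0 : ℤ) * (-1 : ℂ) ^ i *
      Ring.choose ((0 : ℤ) : ℂ) i) • _) 0
    (fun i hi => by rw [Int.cast_zero, choose_zero_of_ne hi]; simp)] at h
  simpa using h

theorem _root_.VertexOperatorAlgebra.mode_zero_omega (A : VertexOperatorAlgebra V) (a : V) :
    A.mode 0 A.omega a = A.mode (-2) a A.vac := by
  rw [← A.creation (A.mode 0 A.omega a), A.derivative]
  simp

/-- The `L(-1)`-derivative property on modules. -/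
theorem mode_derivative (W : A.WeakModule M) (a : V) (n : ℤ) (w : M) :
    W.mode n (A.mode 0 A.omega a) w = (-(n : ℂ)) • W.mode (n - 1) a w := by
  rw [A.mode_zero_omega, mode_mode]
  simp only [W.vacuum, Int.cast_neg, Int.cast_ofNat, choose_neg_two]
  -- Only `𝟏_{-1}` is nonzero. It occurs in the first sum at `i = -1 - n`, possible for `n < 0`, and
  -- in the second at `i = n - 1`, possible for `n > 0`; for `n = 0` both sides vanish.
  rcases lt_trichotomy n 0 with hn | rfl | hn
  · rw [finsum_eq_single _ (-1 - n).toNat, finsum_eq_zero_of_forall_eq_zero, sub_zero]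
    · have h : (((-1 - n).toNat : ℕ) : ℤ) = -1 - n := Int.toNat_of_nonneg (by omega)
      have h' : (((-1 - n).toNat : ℕ) : ℂ) = -1 - n := by exact_mod_cast congrArg (Int.cast : ℤ → ℂ) h
      rw [if_pos (by omega), h, show -2 - (-1 - n) = n - 1 by ring]
      rw [h', ← mul_assoc, ← pow_add, ← two_mul, pow_mul, neg_one_sq, one_pow,
        one_mul]
      module
    · intro i
      rw [if_neg (by omega), smul_zero]
    · intro i hi
      rw [if_neg (by omega), map_zero, smul_zero]
  · rw [finsum_eq_zero_of_forall_eq_zero, finsum_eq_zero_of_forall_eq_zero]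
    · simp
    · intro i
      rw [if_neg (by omega), smul_zero]
    · intro i
      rw [if_neg (by omega), map_zero, smul_zero]
  · rw [finsum_eq_zero_of_forall_eq_zero, finsum_eq_single _ (n - 1).toNat, zero_sub]
    · have h : (((n - 1).toNat : ℕ) : ℤ) = n - 1 := Int.toNat_of_nonneg (by omega)
      have h' : (((n - 1).toNat : ℕ) : ℂ) = n - 1 := by exact_mod_cast congrArg (Int.cast : ℤ → ℂ) h
      rw [if_pos (by omega), h]
      rw [h', mul_assoc, ← mul_assoc ((-1 : ℂ) ^ (n - 1).toNat), ← pow_add, ← two_mul, pow_mul]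
      simp [zpow_neg]
    · intro i hi
      rw [if_neg (by omega), smul_zero]
    · intro i
      rw [if_neg (by omega), map_zero, smul_zero]

theorem commutator_omega_zero (W : A.WeakModule M) (b : V) (n : ℤ) (w : M) :
    W.mode 0 A.omega (W.mode n b w) - W.mode n b (W.mode 0 A.omega w) =
      (-(n : ℂ)) • W.mode (n - 1) b w := by
  rw [commutator, finsum_eq_single _ 0 (fun i hi => by rw [Int.cast_zero, choose_zero_of_ne hi]; simp)]
  simpa using W.mode_derivative b n w

theorem commutator_omega_one (W : A.WeakModule M) {k : ℤ} {b : V} (hb : b ∈ A.weightSpace k)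
    (n : ℤ) (w : M) :
    W.mode 1 A.omega (W.mode n b w) - W.mode n b (W.mode 1 A.omega w) =
      ((k : ℂ) - n - 1) • W.mode n b w := by
  have hb' : A.mode 1 A.omega b = (k : ℂ) • b := Module.End.mem_eigenspace_iff.mp hb
  -- The surviving terms are `(L(-1) b)_{n+1} = -(n+1) b_n` and `(L(0) b)_n = k b_n`.
  rw [commutator, finsum_eq_sum_of_support_subset (s := Finset.range 2)]
  · simp only [Finset.sum_range_succ, Finset.sum_range_zero, Int.cast_one, choose_one]
    have h := W.mode_derivative b (1 + n) w
    rw [add_sub_cancel_left] at h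
    simp only [Nat.choose_zero_right, Nat.choose_self, Nat.cast_zero, Nat.cast_one,
      one_smul, zero_add, sub_zero, h, hb', map_smul, LinearMap.smul_apply,
      add_sub_cancel_left, Int.cast_add]
    module
  · intro i hi
    by_contra hi'
    have : 1 < i := by simpa [Nat.lt_iff_add_one_le] using hi'
    exact hi (by simp [choose_one, Nat.choose_eq_zero_of_lt this])

theorem mode_mem_weightSpace (W : A.WeakModule M) {k : ℤ} {b : V} (hb : b ∈ A.weightSpace k)
    (n : ℤ) {z : ℂ} {w : M} (hw : w ∈ W.weightSpace z) :
    W.mode n b w ∈ W.weightSpace (z + k - n - 1) := by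
  refine Module.End.mem_eigenspace_iff.mpr ?_
  have h := W.commutator_omega_one hb n w
  rw [Module.End.mem_eigenspace_iff.mp hw, map_smul, sub_eq_iff_eq_add] at h
  rw [h]
  module

/-- A vector annihilated by `L(-1)` is annihilated by all `a_n` with `n ≥ 0`. -/
theorem mode_eq_zero_of_vacuumLike (W : A.WeakModule M) {w : M} (hw : W.mode 0 A.omega w = 0)
    (a : V) {n : ℤ} (hn : 0 ≤ n) : W.mode n a w = 0 := by
  obtain ⟨N, hN⟩ := W.truncation a w
  -- Descent from the truncation bound: if `a_{n+1} w = 0`, then `[L(-1), a_{n+1}] w = -(n+1) a_n w`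
  -- forces `a_n w = 0`, because `n + 1 ≠ 0`.
  have key : ∀ j : ℕ, ∀ n : ℤ, 0 ≤ n → N ≤ n + j → W.mode n a w = 0 := by
    intro j
    induction j with
    | zero => exact fun n _ h => hN n (by simpa using h)
    | succ j ih =>
      intro n hn h
      have h1 := W.commutator_omega_zero a (n + 1) w
      rw [ih (n + 1) (by omega) (by push_cast at h ⊢; omega), hw, map_zero, map_zero, sub_zero,
        add_sub_cancel_right, eq_comm, smul_eq_zero] at h1
      refine h1.resolve_left (neg_ne_zero.mpr ?_)
      exact_mod_cast (by omega : n + 1 ≠ 0)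
  exact key (N - n).toNat n hn (by have := Int.self_le_toNat (N - n); omega)

/-- A vacuum-like vector `w` gives a homomorphism `a ↦ a_{-1} w` from `V`. -/
theorem mode_neg_one_mode (W : A.WeakModule M) {w : M} (hw : W.mode 0 A.omega w = 0)
    (a b : V) (n : ℤ) :
    W.mode (-1) (A.mode n a b) w = W.mode n a (W.mode (-1) b w) := by
  have h0 := fun (c : V) (j : ℤ) (hj : 0 ≤ j) => W.mode_eq_zero_of_vacuumLike hw c hj
  -- In the iterate formula the nonnegative modes on `w` drop out, leaving only `a_n b_{-1} w`.
  rw [mode_mode, finsum_eq_single _ 0, finsum_eq_zero_of_forall_eq_zero]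
  · simp
  · intro i
    rw [h0 a i (by omega), map_zero, smul_zero]
  · intro i hi
    rw [h0 b _ (by omega), map_zero, smul_zero]

/-! ### Submodules and quotients -/

/-- The restriction of a module structure to a submodule. -/
def restrict (W : A.WeakModule M) (K : Submodule ℂ M) (hK : W.IsSubmodule K) :
    A.WeakModule K where
  mode n :=
    { toFun := fun a => (W.mode n a).restrict (hK a n)
      map_add' := fun a b => by ext c; simp [LinearMap.restrict_apply]
      map_smul' := fun r a => by ext c; simp [LinearMap.restrict_apply] }
  truncation a w := by
    obtain ⟨N, hN⟩ := W.truncation a w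
    exact ⟨N, fun n hn => Subtype.ext (hN n hn)⟩
  vacuum n w := by
    apply Subtype.ext
    refine (W.vacuum n w).trans ?_
    split_ifs <;> rfl
  jacobi a b w l m n := by
    have key : ∀ f : ℕ → K, ((∑ᶠ i, f i : K) : M) = ∑ᶠ i, (f i : M) := fun f =>
      K.subtype.toAddMonoidHom.map_finsum_of_injective Subtype.val_injective f
    apply Subtype.ext
    rw [Submodule.coe_sub, key, key, key]
    exact W.jacobi a b w l m n

@[simp]
theorem coe_restrict_mode (W : A.WeakModule M) (K : Submodule ℂ M) (hK : W.IsSubmodule K)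
    (n : ℤ) (a : V) (w : K) : ((W.restrict K hK).mode n a w : M) = W.mode n a w := rfl

theorem hasFiniteSupport_of_truncation {E : Type*} [AddCommGroup E] (f : ℕ → E) (N : ℤ)
    (h : ∀ i : ℕ, N ≤ i → f i = 0) : Function.HasFiniteSupport f := by
  refine (Set.finite_lt_nat N.toNat).subset fun i hi => ?_
  by_contra hlt
  exact hi (h i (by simp at hlt; omega))

/-- The quotient of a module by a submodule. -/
def quotient (W : A.WeakModule M) (K : Submodule ℂ M) (hK : W.IsSubmodule K) :
    A.WeakModule (M ⧸ K) where
  mode n :=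
    { toFun := fun a => K.mapQ K (W.mode n a) (hK a n)
      map_add' := fun a b => by ext c; simp
      map_smul' := fun r a => by ext c; simp }
  truncation a w := by
    obtain ⟨w, rfl⟩ := K.mkQ_surjective w
    obtain ⟨N, hN⟩ := W.truncation a w
    refine ⟨N, fun n hn => ?_⟩
    change K.mkQ (W.mode n a w) = 0
    rw [hN n hn, map_zero]
  vacuum n w := by
    obtain ⟨w, rfl⟩ := K.mkQ_surjective w
    change K.mkQ (W.mode n A.vac w) = _
    rw [W.vacuum]
    split_ifs <;> simp
  jacobi a b w l m n := by
    obtain ⟨w, rfl⟩ := K.mkQ_surjective w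
    obtain ⟨N₁, h₁⟩ := W.truncation b w
    obtain ⟨N₂, h₂⟩ := W.truncation a w
    obtain ⟨N₃, h₃⟩ := A.truncation a b
    have h := congrArg K.mkQ (W.jacobi a b w l m n)
    -- The projection is not injective, so it commutes with the sums only through their finite
    -- support, supplied by truncation.
    rw [map_sub, map_finsum _ (hasFiniteSupport_of_truncation _ (N₁ - n) fun i hi => by
        rw [h₁ _ (by omega), map_zero, smul_zero]),
      map_finsum _ (hasFiniteSupport_of_truncation _ (N₂ - m) fun i hi => by
        rw [h₂ _ (by omega), map_zero, smul_zero]),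
      map_finsum _ (hasFiniteSupport_of_truncation _ (N₃ - l) fun i hi => by
        rw [h₃ _ (by omega), map_zero, LinearMap.zero_apply, smul_zero])] at h
    exact h

/-- The restriction of a module structure to a vertex operator subalgebra. -/
def restrictSubalgebra (W : A.WeakModule M) (U : Submodule ℂ V) (hU : A.IsSubalgebra U) :
    (A.subalgebra U hU).WeakModule M where
  mode n := (W.mode n).comp U.subtype
  truncation a w := W.truncation a w
  vacuum n w := W.vacuum n w
  jacobi a b w l m n := W.jacobi a b w l m n

theorem coe_mem_weightSpace (W : A.WeakModule M) (K : Submodule ℂ M) (hK : W.IsSubmodule K)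
    {z : ℂ} {x : K} : (x : M) ∈ W.weightSpace z ↔ x ∈ (W.restrict K hK).weightSpace z := by
  simp only [weightSpace, Module.End.mem_eigenspace_iff, Subtype.ext_iff, coe_restrict_mode,
    Submodule.coe_smul]

theorem IsOrdinary.restrict {W : A.WeakModule M} (hW : W.IsOrdinary) (K : Submodule ℂ M)
    (hK : W.IsSubmodule K) : (W.restrict K hK).IsOrdinary where
  grading := Module.End.iSup_eigenspace_restrict (e := id) K (hK A.omega 1)
    (Module.End.iSup_inf_eigenspace Function.injective_id hW.grading K (hK A.omega 1))
  finite_weight z := by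
    have := hW.finite_weight z
    exact FiniteDimensional.of_injective
      (K.subtype.restrict fun x => (W.coe_mem_weightSpace K hK).mpr) fun x y h =>
        Subtype.ext (Subtype.ext (congrArg (Subtype.val : W.weightSpace z → M) h))
  lower_bound z := by
    obtain ⟨N, hN⟩ := hW.lower_bound z
    refine ⟨N, fun n hn => (Submodule.eq_bot_iff _).mpr fun x hx => Subtype.ext ?_⟩
    have hx' := (W.coe_mem_weightSpace K hK).mpr hx
    rw [hN n hn] at hx'
    exact hx'

theorem weightSpace_quotient {W : A.WeakModule M} (hW : W.IsOrdinary) (K : Submodule ℂ M)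
    (hK : W.IsSubmodule K) (z : ℂ) :
    (W.quotient K hK).weightSpace z = (W.weightSpace z).map K.mkQ :=
  (Module.End.map_eigenspace_of_surjective K.mkQ K.mkQ_surjective (fun _ => rfl)
    hW.grading z).symm

theorem IsOrdinary.quotient {W : A.WeakModule M} (hW : W.IsOrdinary) (K : Submodule ℂ M)
    (hK : W.IsSubmodule K) : (W.quotient K hK).IsOrdinary where
  grading := by
    simp_rw [weightSpace_quotient hW]
    rw [← Submodule.map_iSup, hW.grading, Submodule.map_top, Submodule.range_mkQ]
  finite_weight z := by
    rw [weightSpace_quotient hW]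
    have := hW.finite_weight z
    infer_instance
  lower_bound z := by
    obtain ⟨N, hN⟩ := hW.lower_bound z
    refine ⟨N, fun n hn => ?_⟩
    rw [weightSpace_quotient hW, hN n hn, Submodule.map_bot]

/-! ### Modules over the algebra of modes -/

/-- The associative algebra of operators generated by all modes. -/
def modeAlgebra (W : A.WeakModule M) : Subalgebra ℂ (Module.End ℂ M) :=
  Algebra.adjoin ℂ {f | ∃ (n : ℤ) (a : V), f = W.mode n a}

theorem mode_mem_modeAlgebra (W : A.WeakModule M) (n : ℤ) (a : V) :
    W.mode n a ∈ W.modeAlgebra := Algebra.subset_adjoin ⟨n, a, rfl⟩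

theorem isSubmodule_restrictScalars (W : A.WeakModule M) (K : Submodule W.modeAlgebra M) :
    W.IsSubmodule (K.restrictScalars ℂ) :=
  fun a n _ hw => K.smul_mem ⟨W.mode n a, W.mode_mem_modeAlgebra n a⟩ hw

/-- A submodule as a module over the algebra of modes. -/
def IsSubmodule.toSubmodule {W : A.WeakModule M} {K : Submodule ℂ M} (hK : W.IsSubmodule K) :
    Submodule W.modeAlgebra M :=
  { K with
    smul_mem' := by
      rintro ⟨f, hf⟩ x hx
      change f x ∈ K
      induction hf using Algebra.adjoin_induction generalizing x with
      | mem f hf => obtain ⟨n, a, rfl⟩ := hf; exact hK a n x hx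
      | algebraMap r => exact K.smul_mem r hx
      | add f g _ _ hf hg => exact K.add_mem (hf hx) (hg hx)
      | mul f g _ _ hf hg => exact hf (hg hx) }

/-- Stability under all modes is the same as stability under the algebra they generate, which makes
the theory of semisimple modules over a ring available. -/
theorem isSimpleSubmodule_iff (W : A.WeakModule M) (K : Submodule W.modeAlgebra M) :
    W.IsSimpleSubmodule (K.restrictScalars ℂ) ↔ IsSimpleModule W.modeAlgebra K := by
  rw [isSimpleModule_iff_isAtom, isAtom_iff_le_of_ge]
  constructor
  · rintro ⟨-, hne, h⟩
    refine ⟨fun hb => hne (by rw [hb]; rfl), fun L hL hLK => ?_⟩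
    rcases h (L.restrictScalars ℂ) hLK (W.isSubmodule_restrictScalars L) with h | h
    · exact absurd (SetLike.coe_injective (congrArg (fun S : Submodule ℂ M => (S : Set M)) h) : L = ⊥) hL
    · exact fun x hx => (h ▸ hx : x ∈ L.restrictScalars ℂ)
  · rintro ⟨hne, h⟩
    refine ⟨W.isSubmodule_restrictScalars K, fun hb => hne ?_, fun L hLK hL => ?_⟩
    · exact SetLike.coe_injective (congrArg (fun S : Submodule ℂ M => (S : Set M)) hb)
    · by_cases hb : L = ⊥
      · exact Or.inl hb
      · refine Or.inr (le_antisymm hLK (h hL.toSubmodule (fun hb' => hb ?_) hLK))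
        exact SetLike.coe_injective
          (congrArg (fun S : Submodule W.modeAlgebra M => (S : Set M)) hb')

theorem isCompletelyReducible_of_isSemisimpleModule (W : A.WeakModule M)
    (h : IsSemisimpleModule W.modeAlgebra M) : W.IsCompletelyReducible := by
  obtain ⟨s, hind, hsup, hs⟩ :=
    IsSemisimpleModule.exists_sSupIndep_sSup_simples_eq_top W.modeAlgebra M
  let φ := Submodule.restrictScalarsLatticeHom ℂ W.modeAlgebra M
  have hφ : Function.Injective φ := Submodule.restrictScalars_injective _ _ _
  refine ⟨φ '' s, ?_, ?_, ?_⟩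
  · rintro _ ⟨K, hK, rfl⟩
    exact (W.isSimpleSubmodule_iff K).mpr (hs K hK)
  · rintro _ ⟨K, hK, rfl⟩
    rw [← Set.image_singleton, ← Set.image_sdiff hφ, ← map_sSup φ]
    rw [disjoint_iff, ← map_inf, disjoint_iff.mp (hind hK), map_bot]
  · rw [← map_sSup φ, hsup, map_top]

/-! ### The part of integral weights -/

/-- The sum of the weight spaces of integral weight. -/
def integralPart (W : A.WeakModule M) : Submodule ℂ M := ⨆ n : ℤ, W.weightSpace n

theorem weightSpace_le_integralPart (W : A.WeakModule M) (n : ℤ) :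
    W.weightSpace n ≤ W.integralPart := le_iSup (fun n : ℤ => W.weightSpace n) n

/-- A homogeneous `a` of weight `k` shifts weights by the integer `k - n - 1` through `a_n`. -/
theorem isSubmodule_integralPart (W : A.WeakModule M) : W.IsSubmodule W.integralPart := by
  intro a n w hw
  have ha : a ∈ ⨆ k : ℤ, A.weightSpace k := by
    have := A.grading
    exact this ▸ Submodule.mem_top
  induction ha using Submodule.iSup_induction' with
  | zero => simp
  | add a b _ _ ha hb => rw [map_add]; exact add_mem ha hb
  | mem k a ha =>
    induction hw using Submodule.iSup_induction' with
    | zero => simp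
    | add a b _ _ ha hb => rw [map_add]; exact add_mem ha hb
    | mem m w hw =>
      refine W.weightSpace_le_integralPart (m + k - n - 1) ?_
      exact_mod_cast W.mode_mem_weightSpace ha n hw

/-- The part of integral weights as a module. -/
def integralModule (W : A.WeakModule M) : A.WeakModule W.integralPart :=
  W.restrict W.integralPart W.isSubmodule_integralPart

theorem iSup_weightSpace_integralModule (W : A.WeakModule M) :
    ⨆ n : ℤ, W.integralModule.weightSpace n = ⊤ := by
  refine Module.End.iSup_eigenspace_restrict (e := fun n : ℤ => (n : ℂ)) W.integralPart
    (W.isSubmodule_integralPart A.omega 1) ?_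
  exact iSup_congr fun n => inf_eq_right.mpr (W.weightSpace_le_integralPart n)

/-- An ordinary module whose weights are integers is admissible, graded by shifted weights. -/
theorem exists_isAdmissible {W : A.WeakModule M} (hW : W.IsOrdinary)
    (h : ⨆ n : ℤ, W.weightSpace n = ⊤) :
    ∃ N : ℤ, W.IsAdmissible fun n => W.weightSpace ((n + N : ℤ) : ℂ) := by
  -- All integral weights are at least `N`, so the grading shifted by `N` starts in degree `0` or
  -- later.
  obtain ⟨N, hN⟩ := hW.lower_bound 0
  refine ⟨N, ?_, fun n hn => ?_, fun k a ha m n w hw => ?_⟩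
  · rw [DirectSum.isInternal_submodule_iff_iSupIndep_and_iSup_eq_top]
    refine ⟨(Module.End.eigenspaces_iSupIndep _).comp (f := fun n : ℤ => ((n + N : ℤ) : ℂ))
      (Int.cast_injective.comp (add_left_injective N)), ?_⟩
    rw [← h]
    exact (Equiv.addRight N).iSup_comp (g := fun n : ℤ => W.weightSpace n)
  · simpa using hN (n + N) (by omega)
  · convert W.mode_mem_weightSpace ha m hw using 2
    push_cast
    ring

/-- Ordinary modules of integral weights over a rational vertex operator algebra are semisimple. -/
theorem isSemisimpleModule_of_isRational {M : Type u} [AddCommGroup M] [Module ℂ M]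
    (hA : A.IsRational) {W : A.WeakModule M} (hW : W.IsOrdinary)
    (h : ⨆ n : ℤ, W.weightSpace n = ⊤) : IsSemisimpleModule W.modeAlgebra M := by
  obtain ⟨N, hN⟩ := exists_isAdmissible hW h
  obtain ⟨S, hS, -, hsup⟩ := hA M W _ hN
  -- The pieces of the grading are eigenspaces of `L(0)`, so every submodule is graded, and simple
  -- among graded submodules means simple.
  have hgr : ∀ K, W.IsSubmodule K →
      W.IsGradedSubmodule (fun n => W.weightSpace ((n + N : ℤ) : ℂ)) K := fun K hK =>
    ⟨hK, Module.End.iSup_inf_eigenspace (Int.cast_injective.comp (add_left_injective N))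
      ((DirectSum.isInternal_submodule_iff_iSupIndep_and_iSup_eq_top _).mp hN.internal).2 K
      (hK A.omega 1)⟩
  rw [← sSup_simples_eq_top_iff_isSemisimpleModule]
  apply Submodule.restrictScalars_injective ℂ
  refine top_unique (hsup ▸ ?_ : (⊤ : Submodule ℂ M) ≤ _)
  refine sSup_le fun K hK => ?_
  obtain ⟨⟨hsub, -⟩, hne, hmin⟩ := hS K hK
  have hsimple : IsSimpleModule W.modeAlgebra hsub.toSubmodule :=
    (W.isSimpleSubmodule_iff hsub.toSubmodule).mp
      ⟨hsub, hne, fun K' hle hK' => hmin K' hle (hgr K' hK')⟩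
  exact le_sSup (a := hsub.toSubmodule) hsimple

theorem exists_isCompl_of_isRational {M : Type u} [AddCommGroup M] [Module ℂ M]
    (hA : A.IsRational) {W : A.WeakModule M} (hW : W.IsOrdinary)
    (h : ⨆ n : ℤ, W.weightSpace n = ⊤) {K : Submodule ℂ M} (hK : W.IsSubmodule K) :
    ∃ C, W.IsSubmodule C ∧ IsCompl K C := by
  have := isSemisimpleModule_of_isRational hA hW h
  obtain ⟨C, hC⟩ := exists_isCompl hK.toSubmodule
  exact ⟨C.restrictScalars ℂ, W.isSubmodule_restrictScalars C,
    hC.map (Submodule.restrictScalarsLatticeHom ℂ W.modeAlgebra M)⟩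

/-! ### Lifting the vacuum vector -/

variable {M : Type u} [AddCommGroup M] [Module ℂ M]

/-- `U` has the same `ω`, so `L(0)` and its eigenspaces do not change. -/
theorem IsOrdinary.restrictSubalgebra {W : A.WeakModule M} (hW : W.IsOrdinary)
    (U : Submodule ℂ V) (hU : A.IsSubalgebra U) : (W.restrictSubalgebra U hU).IsOrdinary :=
  ⟨hW.grading, hW.finite_weight, hW.lower_bound⟩

/-- A surjective homomorphism onto `V` is split on the level of the vacuum vector. -/
theorem exists_vacuumLike_lift {U : Submodule ℂ V} {hU : A.IsSubalgebra U}
    (hrat : (A.subalgebra U hU).IsRational) {W : A.WeakModule M} (hW : W.IsOrdinary)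
    (g : M →ₗ[ℂ] V) (hg : Function.Surjective g)
    (hc : ∀ (a : V) (n : ℤ) (w : M), g (W.mode n a w) = A.mode n a (g w)) :
    ∃ w : M, W.mode 0 A.omega w = 0 ∧ g w = A.vac := by
  let W' := W.integralModule.restrictSubalgebra U hU
  let g' : W.integralPart →ₗ[ℂ] V := g.comp W.integralPart.subtype
  have hker : W'.IsSubmodule (LinearMap.ker g') := by
    intro a n w hw
    change g (W.mode n a w) = 0
    rw [hc, show g w = 0 from hw, map_zero]
  obtain ⟨C, hCsub, hC⟩ := exists_isCompl_of_isRational hrat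
    ((hW.restrict _ W.isSubmodule_integralPart).restrictSubalgebra U hU)
    W.iSup_weightSpace_integralModule hker
  have hvac : A.vac ∈ A.regular.weightSpace 0 := by
    refine Module.End.mem_eigenspace_iff.mpr ?_
    rw [zero_smul]
    exact A.creation_nonneg _ _ zero_le_one
  -- The vacuum has weight `0`, so it lifts to weight `0`, inside the integral part.
  obtain ⟨m, hm, hgm⟩ : A.vac ∈ (W.weightSpace 0).map g := by
    have h := Module.End.map_eigenspace_of_surjective (f' := A.regular.mode 1 A.omega) g hg
      (hc A.omega 1) hW.grading 0
    exact h ▸ hvac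
  have hm' : m ∈ W.integralPart :=
    W.weightSpace_le_integralPart 0 (by simpa using hm)
  obtain ⟨k, hk, c, hcC, hkc⟩ := Submodule.mem_sup.mp
    (hC.sup_eq_top ▸ Submodule.mem_top (x := (⟨m, hm'⟩ : W.integralPart)))
  have hgc : g c = A.vac := by
    have h1 : g k = 0 := hk
    have h2 : (k : M) + c = m := congrArg Subtype.val hkc
    rw [← hgm, ← h2, map_add, h1, zero_add]
  refine ⟨c, ?_, hgc⟩
  -- Here `ω ∈ U` is essential: the complement is stable only under modes of `U`.
  have hLc : W'.mode 0 ⟨A.omega, hU.omega_mem⟩ c ∈ C := hCsub _ _ _ hcC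
  have hLk : W'.mode 0 ⟨A.omega, hU.omega_mem⟩ c ∈ LinearMap.ker g' := by
    change g (W.mode 0 A.omega c) = 0
    rw [hc, hgc, A.creation_nonneg _ _ le_rfl]
  exact congrArg Subtype.val (Submodule.disjoint_def.mp hC.disjoint _ hLk hLc)

/-- The submodule generated by a nonzero vacuum-like vector is simple if `V` is. -/
theorem isSimpleSubmodule_of_vacuumLike (hA : A.regular.IsSimple) (W : A.WeakModule M) {w : M}
    (hw : W.mode 0 A.omega w = 0) (hne : w ≠ 0) :
    W.IsSimpleSubmodule (LinearMap.range ((W.mode (-1)).flip w)) := by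
  have hwmem : w ∈ LinearMap.range ((W.mode (-1)).flip w) :=
    ⟨A.vac, by simp [W.vacuum]⟩
  -- Pulled back along `a ↦ a_{-1} w`, a submodule becomes an ideal of `V`, hence `0` or `V`.
  have hcomap : ∀ K, W.IsSubmodule K → A.regular.IsSubmodule (K.comap ((W.mode (-1)).flip w)) := by
    intro K hK a n b hb
    change W.mode (-1) (A.mode n a b) w ∈ K
    rw [W.mode_neg_one_mode hw]
    exact hK a n _ hb
  refine ⟨?_, fun h => hne ((Submodule.mem_bot ℂ).mp (h ▸ hwmem)), fun K hle hK => ?_⟩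
  · rintro a n _ ⟨b, rfl⟩
    exact ⟨A.mode n a b, W.mode_neg_one_mode hw a b n⟩
  · rw [← Submodule.map_comap_eq_of_le hle]
    rcases hA.2.2 _ le_top (hcomap K hK) with h | h
    · left; rw [h, Submodule.map_bot]
    · right; rw [h, Submodule.map_top]


/-! ### Simple subquotients and semisimplicity -/

/-- A minimal subquotient is a simple module. -/
theorem isSimple_quotient_restrict (W : A.WeakModule M) {C P : Submodule ℂ M}
    (hP : W.IsSubmodule P)
    (hC : (W.restrict P hP).IsSubmodule (C.comap P.subtype)) (hlt : C < P)
    (h : ∀ K, W.IsSubmodule K → C ≤ K → K ≤ P → K = C ∨ K = P) :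
    ((W.restrict P hP).quotient _ hC).IsSimple := by
  refine ⟨fun _ _ _ _ => trivial, fun htop => ?_, fun L _ hL => ?_⟩
  · obtain ⟨x, hxP, hxC⟩ := SetLike.exists_of_lt hlt
    have hx : (C.comap P.subtype).mkQ ⟨x, hxP⟩ ∈ (⊥ : Submodule ℂ _) :=
      htop ▸ Submodule.mem_top
    exact hxC ((Submodule.Quotient.mk_eq_zero (C.comap P.subtype)).mp hx)
  · let K := (L.comap (C.comap P.subtype).mkQ).map P.subtype
    have hsub : W.IsSubmodule K := by
      rintro a n _ ⟨y, hy, rfl⟩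
      exact ⟨(W.restrict P hP).mode n a y, hL a n _ hy, rfl⟩
    have hmem : ∀ y : P, (y : M) ∈ K ↔ (C.comap P.subtype).mkQ y ∈ L := fun y =>
      ⟨fun ⟨z, hz, hzy⟩ => Subtype.ext hzy ▸ hz, fun hy => ⟨y, hy, rfl⟩⟩
    have hCK : C ≤ K := fun x hx => by
      refine (hmem ⟨x, hlt.le hx⟩).mpr ?_
      rw [show (C.comap P.subtype).mkQ ⟨x, hlt.le hx⟩ = 0 from
        (Submodule.Quotient.mk_eq_zero (C.comap P.subtype)).mpr hx]
      exact L.zero_mem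
    rcases h K hsub hCK (Submodule.map_subtype_le _ _) with hK | hK
    · refine Or.inl ((Submodule.eq_bot_iff _).mpr fun q hq => ?_)
      obtain ⟨y, rfl⟩ := (C.comap P.subtype).mkQ_surjective q
      exact (Submodule.Quotient.mk_eq_zero (C.comap P.subtype)).mpr (hK ▸ (hmem y).mpr hq)
    · refine Or.inr (eq_top_iff.mpr fun q _ => ?_)
      obtain ⟨y, rfl⟩ := (C.comap P.subtype).mkQ_surjective q
      exact (hmem y).mp (hK.symm.le y.2)

/-- Over a holomorphic `V` with a rational subalgebra, every minimal inclusion of submodules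
`C < P` is witnessed by a simple submodule of `P` that is not contained in `C`. -/
theorem exists_isSimpleSubmodule_not_le (hA : A.IsHolomorphic)
    {U : Submodule ℂ V} {hU : A.IsSubalgebra U} (hrat : (A.subalgebra U hU).IsRational)
    {W : A.WeakModule M} (hW : W.IsOrdinary) {C P : Submodule ℂ M} (hP : W.IsSubmodule P)
    (hC : W.IsSubmodule C) (hlt : C < P)
    (h : ∀ K, W.IsSubmodule K → C ≤ K → K ≤ P → K = C ∨ K = P) :
    ∃ K, W.IsSimpleSubmodule K ∧ K ≤ P ∧ ¬ K ≤ C := by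
  have hC' : (W.restrict P hP).IsSubmodule (C.comap P.subtype) :=
    fun a n w hw => hC a n w hw
  have hWP := hW.restrict P hP
  obtain ⟨e, he⟩ := hA.2 _ _ (hWP.quotient _ hC') (W.isSimple_quotient_restrict hP hC' hlt h)
  obtain ⟨w, hw, hgw⟩ := exists_vacuumLike_lift hrat hWP
    (e.toLinearMap.comp (C.comap P.subtype).mkQ)
    (e.surjective.comp (C.comap P.subtype).mkQ_surjective)
    (fun a n w => he a n ((C.comap P.subtype).mkQ w))
  -- If `𝟏 = 0`, then `b = 𝟏_{-1} b = 0` for all `b`, but a simple `V` is nonzero.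
  have hvac : A.vac ≠ 0 := fun h0 => hA.1.2.2.1 <| (Submodule.eq_bot_iff _).mpr fun b _ => by
    simpa [h0] using (A.vacuum (-1) b).symm
  have hwC : (w : M) ∉ C := fun hmem => hvac <| by
    rw [← hgw, LinearMap.comp_apply,
      show (C.comap P.subtype).mkQ w = 0 from (Submodule.Quotient.mk_eq_zero _).mpr hmem, map_zero]
  refine ⟨_, W.isSimpleSubmodule_of_vacuumLike hA.1.2 (congrArg Subtype.val hw)
    (fun h0 : (w : M) = 0 => hwC (h0 ▸ C.zero_mem)), ?_, fun hle => hwC (hle ⟨A.vac, by simp [W.vacuum]⟩)⟩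
  rintro _ ⟨b, rfl⟩
  exact hP b (-1) w w.2

/-- If `V` is holomorphic and has a rational subalgebra, ordinary modules are semisimple. -/
theorem isSemisimpleModule_of_isHolomorphic (hA : A.IsHolomorphic)
    {U : Submodule ℂ V} {hU : A.IsSubalgebra U} (hrat : (A.subalgebra U hU).IsRational)
    {W : A.WeakModule M} (hW : W.IsOrdinary) : IsSemisimpleModule W.modeAlgebra M := by
  rw [← sSup_simples_eq_top_iff_isSemisimpleModule]
  by_contra hne
  obtain ⟨x, -, hx⟩ := SetLike.exists_of_lt (lt_top_iff_ne_top.mpr hne)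
  let P := Submodule.span W.modeAlgebra {x}
  have hPx : x ∈ P := Submodule.mem_span_singleton_self x
  -- A cyclic submodule is compact, so each proper submodule of `P`, in particular `P ∩ S`, lies in
  -- a maximal one.
  have := CompleteLattice.Iic_coatomic_of_compact_element
    (Submodule.singleton_span_isCompactElement (R := W.modeAlgebra) x)
  obtain ⟨⟨C, hCP⟩, hC, hSC⟩ := (eq_top_or_exists_le_coatom
    (⟨P ⊓ _, Set.mem_Iic.mpr inf_le_left⟩ : Set.Iic P)).resolve_left fun h =>
      hx (inf_eq_left.mp (congrArg Subtype.val h) hPx)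
  have hcov : C ⋖ P := (covBy_iff_coatom_Iic hCP).mpr hC
  obtain ⟨K, hK, hKP, hKC⟩ := exists_isSimpleSubmodule_not_le hA hrat hW
    (W.isSubmodule_restrictScalars P) (W.isSubmodule_restrictScalars C) hcov.lt
    (fun K hK h₁ h₂ => (hcov.eq_or_eq (c := hK.toSubmodule) h₁ h₂).imp
      (congrArg fun S : Submodule W.modeAlgebra M => S.restrictScalars ℂ)
      (congrArg fun S : Submodule W.modeAlgebra M => S.restrictScalars ℂ))
  have hKS : hK.1.toSubmodule ≤ sSup {K : Submodule W.modeAlgebra M | IsSimpleModule W.modeAlgebra K} :=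
    le_sSup ((W.isSimpleSubmodule_iff hK.1.toSubmodule).mp hK)
  -- Being simple and inside `P`, `K` lies in `P ∩ S ≤ C`, a contradiction.
  exact hKC fun y hy => hSC (show y ∈ P ⊓ _ from ⟨hKP hy, hKS hy⟩)

end WeakModule
end VertexOperatorAlgebra

theorem proposition9 {V : Type u} [AddCommGroup V] [Module ℂ V]
    (A : VertexOperatorAlgebra V) (hA : A.IsHolomorphic)
    (U : Submodule ℂ V) (hU : A.IsSubalgebra U) (hrat : (A.subalgebra U hU).IsRational)
    {M : Type u} [AddCommGroup M] [Module ℂ M]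
    (W : A.WeakModule M) (hW : W.IsOrdinary) :
    W.IsCompletelyReducible :=
  W.isCompletelyReducible_of_isSemisimpleModule
    (VertexOperatorAlgebra.WeakModule.isSemisimpleModule_of_isHolomorphic hA hrat hW)
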